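/- Let $D$ be an integral domain with quotient field $K$. For a nonzero $D$-submodule $E$ of $K$ put $E^{-1}=\{x\in K : xE\subseteq D\}$, $E^v=(E^{-1})^{-1}$ and $E^t=\bigcup\{F^v : F\subseteq E,\ F \text{ a nonzero finitely generated } D\text{-submodule}\}$. A nonzero ideal $I$ of $D$ is a $t$-ideal if $I=I^t$, divisorial if $I=I^v$, and $t$-idempotent if $I^t=(I^2)^t$. A $t$-prime is a prime ideal that is a (nonzero) $t$-ideal, and a $t$-maximal ideal is a maximal element of the set of proper $t$-ideals. An ideal $I$ is a $t$-product of ideals $P_1,\dots,P_n$ ($n\ge 0$, the empty product being $D$) if $I=(P_1\cdots P_n)^t$. The domain $D$ is a P$v$MD (Prüfer $v$-multiplication domain) if $(FF^{-1})^t=D$ for every nonzero finitely generated $D$-submodule $F$ of $K$, and it has finite $t$-character if every nonzero element of $D$ lies in only finitely many $t$-maximal ideals. Let $D$ be a P$v$MD of finite $t$-character, and let $I$ be a nonzero $t$-ideal of $D$. Then: 1. $I$ is $t$-idempotent if and only if $I$ is a $t$-product of $t$-idempotent $t$-primes of $D$. 2. The following statements are equivalent: (a) $I$ is $t$-idempotent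 and divisorial. (b) $I$ is a $t$-product of non-$t$-maximal $t$-idempotent $t$-primes. (c) $I$ is a $t$-product of divisorial $t$-idempotent $t$-primes. (d) $I$ has a unique (up to the order of the factors) representation as a $t$-product of pairwise incomparable divisorial $t$-idempotent $t$-primes. -/

import Mathlib

/-! The `v`- and `t`-operations on a domain `D` with quotient field `K` (the definitions are only
used under `[IsDomain D]` and `[IsFractionRing D K]`).
Fractional ideals are treated as `D`-submodules of `K`; `1 : Submodule D K` is the image of `D`,
and `1 / E` is `E⁻¹ = {x ∈ K | x E ⊆ D}`. -/

namespace StarOp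

variable (D : Type*) (K : Type*) [CommRing D] [Field K] [Algebra D K]

variable {D K} in
/-- The `v`-closure `E^v = (E⁻¹)⁻¹`. -/
def vClosure (E : Submodule D K) : Submodule D K := 1 / (1 / E)

variable {D K} in
theorem vClosure_mono {E F : Submodule D K} (h : E ≤ F) : vClosure E ≤ vClosure F := by
  intro x hx
  rw [vClosure, Submodule.mem_div_iff_forall_mul_mem] at hx ⊢
  intro y hy
  refine hx y ?_
  rw [Submodule.mem_div_iff_forall_mul_mem] at hy ⊢
  exact fun z hz => hy z (h hz)

variable {D K} in
/-- The `t`-closure `E^t = ⋃ {F^v | F ⊆ E finitely generated}`. For `E ≠ 0` it makes no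
difference whether `F = 0` is allowed. -/
def tClosure (E : Submodule D K) : Submodule D K where
  carrier := {x | ∃ F : Submodule D K, F.FG ∧ F ≤ E ∧ x ∈ vClosure F}
  zero_mem' := ⟨⊥, Submodule.fg_bot, bot_le, Submodule.zero_mem _⟩
  add_mem' := by
    rintro x y ⟨F, hF, hFE, hx⟩ ⟨G, hG, hGE, hy⟩
    exact ⟨F ⊔ G, hF.sup hG, sup_le hFE hGE,
      Submodule.add_mem _ (vClosure_mono le_sup_left hx) (vClosure_mono le_sup_right hy)⟩
  smul_mem' := by
    rintro c x ⟨F, hF, hFE, hx⟩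
    exact ⟨F, hF, hFE, Submodule.smul_mem _ c hx⟩

variable {D} in
/-- An ideal of `D`, viewed as a `D`-submodule of `K`. -/
abbrev toK (I : Ideal D) : Submodule D K := IsLocalization.coeSubmodule K I

variable {D} in
/-- `I` is a (nonzero) `t`-ideal: `I = I^t`. -/
def IsTIdeal (I : Ideal D) : Prop := I ≠ ⊥ ∧ tClosure (toK K I) = toK K I

variable {D} in
/-- `P` is a `t`-prime: a prime `t`-ideal. -/
def IsTPrime (P : Ideal D) : Prop := P.IsPrime ∧ IsTIdeal K P

variable {D} in
/-- `M` is `t`-maximal: maximal among the proper `t`-ideals. -/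
def IsTMaximal (M : Ideal D) : Prop := Maximal (fun J : Ideal D => J ≠ ⊤ ∧ IsTIdeal K J) M

variable {D} in
/-- `I` is divisorial: `I = I^v`. -/
def IsDivisorial (I : Ideal D) : Prop := vClosure (toK K I) = toK K I

variable {D} in
/-- `I` is `t`-idempotent: `I^t = (I²)^t`. -/
def IsTIdempotent (I : Ideal D) : Prop := tClosure (toK K I) = tClosure (toK K (I ^ 2))

/-- `D` is a Prüfer `v`-multiplication domain: every nonzero finitely generated `D`-submodule
`F` of `K` is `t`-invertible, `(F F⁻¹)^t = D`. -/
def IsPvMD : Prop :=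
  ∀ F : Submodule D K, F ≠ ⊥ → F.FG → tClosure (F * (1 / F)) = 1

/-- `D` has finite `t`-character: every nonzero element of `D` lies in only finitely many
`t`-maximal ideals. -/
def HasFiniteTCharacter : Prop :=
  ∀ x : D, x ≠ 0 → {M : Ideal D | IsTMaximal K M ∧ x ∈ M}.Finite

variable {D} in
/-- `I` is the `t`-product of the ideals in `s` (counted with multiplicity):
`I = (P₁ ⋯ Pₙ)^t`. The empty product is `D`. -/
def IsTProduct (I : Ideal D) (s : Multiset (Ideal D)) : Prop :=
  toK K I = tClosure (toK K s.prod)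

variable {D} in
/-- The ideals in `s` are pairwise incomparable (in particular none is repeated). -/
def Incomparable (s : Multiset (Ideal D)) : Prop :=
  s.Nodup ∧ ∀ P ∈ s, ∀ Q ∈ s, P ≠ Q → ¬ P ≤ Q

end StarOp

/-! In a P`v`MD, `D_M` is a valuation domain for every `t`-prime `M`, and `t`-closed modules are
determined by their localizations at the `t`-maximal ideals (`mem_of_forall_isTMaximal`,
`IsPvMD.tClosure_le_localAt`). If `I` is `t`-idempotent, each `I_M` is idempotent, and a proper
idempotent ideal of a valuation domain is prime; so `I D_M ∩ D` is a `t`-idempotent `t`-prime. Only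
finitely many `M` contain `I`, so `I` is the intersection of the minimal ones among these
contractions. Incomparable `t`-primes never share a `t`-maximal ideal, hence their intersection is
their `t`-product.

For divisoriality, a `t`-idempotent `t`-maximal `M` has `M⁻¹ = D`, so it cannot be a factor of a
divisorial ideal (`IsDivisorial.not_isTMaximal_of_mem`). Conversely, finite `t`-character makes
every other `t`-prime divisorial (`IsTPrime.isDivisorial`), and intersections of divisorial ideals
are divisorial. Uniqueness is the usual argument with minimal primes. -/

namespace StarOp

set_option linter.unusedSectionVars false

/-! ### Formal properties of the `v`- and `t`-closures; colon ideals and localizations inside `K`.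
-/

section Closure

variable {D K : Type*} [CommRing D] [Field K] [Algebra D K]

theorem le_vClosure (E : Submodule D K) : E ≤ vClosure E := by
  intro x hx
  rw [vClosure, Submodule.mem_div_iff_forall_mul_mem]
  intro y hy
  rw [mul_comm]
  exact Submodule.mem_div_iff_forall_mul_mem.1 hy x hx

theorem vClosure_vClosure (E : Submodule D K) : vClosure (vClosure E) = vClosure E := by
  refine le_antisymm ?_ (le_vClosure _)
  intro x hx
  rw [vClosure, Submodule.mem_div_iff_forall_mul_mem] at hx ⊢
  intro y hy
  exact hx y (le_vClosure (1 / E) hy)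

theorem vClosure_one : vClosure (1 : Submodule D K) = 1 := by
  have h : (1 : Submodule D K) / 1 = 1 := by
    ext x
    rw [Submodule.mem_div_iff_forall_mul_mem]
    refine ⟨fun h => by simpa using h 1 (Submodule.one_le.1 le_rfl), fun h y hy => ?_⟩
    simpa using Submodule.mul_mem_mul h hy
  rw [vClosure, h, h]

theorem mul_mem_vClosure (x : K) {E : Submodule D K} {y : K} (hy : y ∈ vClosure E) :
    x * y ∈ vClosure (Submodule.span D {x} * E) := by
  rw [vClosure, Submodule.mem_div_iff_forall_mul_mem] at hy ⊢
  intro z hz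
  have hzx : x * z ∈ 1 / E := by
    rw [Submodule.mem_div_iff_forall_mul_mem] at hz ⊢
    intro e he
    have := hz (x * e) (Submodule.mul_mem_mul (Submodule.mem_span_singleton_self x) he)
    rwa [show x * z * e = z * (x * e) by ring]
  rw [show x * y * z = y * (x * z) by ring]
  exact hy _ hzx

theorem le_tClosure (E : Submodule D K) : E ≤ tClosure E := fun x hx =>
  ⟨Submodule.span D {x}, Submodule.fg_span_singleton x,
    (Submodule.span_singleton_le_iff_mem x E).2 hx,
    le_vClosure _ (Submodule.mem_span_singleton_self x)⟩

theorem tClosure_mono {E F : Submodule D K} (h : E ≤ F) : tClosure E ≤ tClosure F := by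
  rintro x ⟨G, hG, hGE, hx⟩
  exact ⟨G, hG, hGE.trans h, hx⟩

theorem tClosure_le_vClosure (E : Submodule D K) : tClosure E ≤ vClosure E := by
  rintro x ⟨G, _, hGE, hx⟩
  exact vClosure_mono hGE hx

theorem vClosure_le_tClosure {E : Submodule D K} (hE : E.FG) : vClosure E ≤ tClosure E :=
  fun _ hx => ⟨E, hE, le_rfl, hx⟩

theorem exists_fg_le_vClosure_of_le_tClosure {E F : Submodule D K} (hF : F.FG)
    (h : F ≤ tClosure E) : ∃ G : Submodule D K, G.FG ∧ G ≤ E ∧ F ≤ vClosure G := by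
  induction F, hF using Submodule.fg_induction with
  | singleton x =>
    obtain ⟨G, hG, hGE, hx⟩ := h (Submodule.mem_span_singleton_self x)
    exact ⟨G, hG, hGE, (Submodule.span_singleton_le_iff_mem x _).2 hx⟩
  | sup F₁ F₂ _ _ ih₁ ih₂ =>
    obtain ⟨G₁, hG₁, hE₁, h₁⟩ := ih₁ (le_sup_left.trans h)
    obtain ⟨G₂, hG₂, hE₂, h₂⟩ := ih₂ (le_sup_right.trans h)
    exact ⟨G₁ ⊔ G₂, hG₁.sup hG₂, sup_le hE₁ hE₂,
      sup_le (h₁.trans (vClosure_mono le_sup_left)) (h₂.trans (vClosure_mono le_sup_right))⟩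

theorem tClosure_tClosure (E : Submodule D K) : tClosure (tClosure E) = tClosure E := by
  refine le_antisymm ?_ (le_tClosure _)
  rintro x ⟨F, hF, hFE, hx⟩
  obtain ⟨G, hG, hGE, hFG⟩ := exists_fg_le_vClosure_of_le_tClosure hF hFE
  refine ⟨G, hG, hGE, ?_⟩
  rw [← vClosure_vClosure G]
  exact vClosure_mono hFG hx

theorem tClosure_one : tClosure (1 : Submodule D K) = 1 :=
  le_antisymm ((tClosure_le_vClosure _).trans vClosure_one.le) (le_tClosure _)

theorem mul_mem_tClosure (x : K) {E : Submodule D K} {y : K} (hy : y ∈ tClosure E) :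
    x * y ∈ tClosure (Submodule.span D {x} * E) := by
  obtain ⟨F, hF, hFE, hy⟩ := hy
  exact ⟨_, (Submodule.fg_span_singleton x).mul hF, mul_le_mul_right hFE _,
    mul_mem_vClosure x hy⟩

theorem toK_mono {I J : Ideal D} (h : I ≤ J) : toK K I ≤ toK K J :=
  IsLocalization.coeSubmodule_mono K h

theorem toK_le_one (I : Ideal D) : toK K I ≤ 1 := by
  rw [← IsLocalization.coeSubmodule_top (R := D) (S := K)]
  exact toK_mono le_top

theorem toK_mul (I J : Ideal D) : toK K (I * J) = toK K I * toK K J :=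
  IsLocalization.coeSubmodule_mul K I J

theorem tClosure_toK_le_one (I : Ideal D) : tClosure (toK K I) ≤ 1 :=
  (tClosure_mono (toK_le_one I)).trans tClosure_one.le

theorem toK_pow_two (I : Ideal D) : toK K (I ^ 2) = toK K I * toK K I := by
  rw [pow_two, toK_mul]

/-- The ideal of all `d : D` with `d • x ∈ E`. -/
def colonElem (E : Submodule D K) (x : K) : Ideal D :=
  E.comap (LinearMap.toSpanSingleton D K x)

theorem mem_colonElem {E : Submodule D K} {x : K} {d : D} : d ∈ colonElem E x ↔ d • x ∈ E :=
  Iff.rfl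

theorem tClosure_toK_eq_of_forall {I : Ideal D}
    (h : ∀ d : D, algebraMap D K d ∈ tClosure (toK K I) → d ∈ I) :
    tClosure (toK K I) = toK K I := by
  refine le_antisymm (fun x hx => ?_) (le_tClosure _)
  obtain ⟨d, rfl⟩ := Submodule.mem_one.1 (tClosure_toK_le_one I hx)
  exact (IsLocalization.mem_coeSubmodule K I).2 ⟨d, h d hx, rfl⟩

/-- If `d ∈ A^t` with `A = (E : x)`, then `xd ∈ (xA)^t ⊆ E^t = E`. -/
theorem tClosure_toK_colonElem {E : Submodule D K} (hE : tClosure E = E) (x : K) :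
    tClosure (toK K (colonElem E x)) = toK K (colonElem E x) := by
  refine tClosure_toK_eq_of_forall fun d hd => ?_
  rw [mem_colonElem, Algebra.smul_def, mul_comm, ← hE]
  refine tClosure_mono ?_ (mul_mem_tClosure x hd)
  refine Submodule.mul_le.2 fun y hy z hz => ?_
  obtain ⟨c, rfl⟩ := Submodule.mem_span_singleton.1 hy
  obtain ⟨d, hd, rfl⟩ := (IsLocalization.mem_coeSubmodule K _).1 hz
  rw [smul_mul_assoc, mul_comm, ← Algebra.smul_def]
  exact E.smul_mem c hd

/-- The localization `E_M`, taken inside `K`. -/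
def localAt (M : Ideal D) [M.IsPrime] (E : Submodule D K) : Submodule D K where
  carrier := {x | ∃ s ∉ M, s • x ∈ E}
  zero_mem' := ⟨1, M.one_notMem, by simp⟩
  add_mem' := by
    rintro x y ⟨s, hs, hx⟩ ⟨t, ht, hy⟩
    refine ⟨s * t, Ideal.IsPrime.mul_notMem ‹_› hs ht, ?_⟩
    rw [smul_add, mul_smul s t y, mul_comm, mul_smul]
    exact E.add_mem (E.smul_mem _ hx) (E.smul_mem _ hy)
  smul_mem' := by
    rintro c x ⟨s, hs, hx⟩
    refine ⟨s, hs, ?_⟩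
    rw [smul_comm]
    exact E.smul_mem _ hx

theorem mem_localAt {M : Ideal D} [M.IsPrime] {E : Submodule D K} {x : K} :
    x ∈ localAt M E ↔ ∃ s ∉ M, s • x ∈ E := Iff.rfl

theorem le_localAt (M : Ideal D) [M.IsPrime] (E : Submodule D K) : E ≤ localAt M E :=
  fun x hx => ⟨1, M.one_notMem, by simpa using hx⟩

theorem localAt_le_localAt {M : Ideal D} [M.IsPrime] {E F : Submodule D K}
    (h : E ≤ localAt M F) : localAt M E ≤ localAt M F := by
  rintro x ⟨s, hs, hx⟩
  obtain ⟨t, ht, hx⟩ := h hx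
  exact ⟨t * s, Ideal.IsPrime.mul_notMem ‹_› ht hs, by rwa [mul_smul]⟩

theorem localAt_mono {M : Ideal D} [M.IsPrime] {E F : Submodule D K} (h : E ≤ F) :
    localAt M E ≤ localAt M F :=
  localAt_le_localAt (h.trans (le_localAt M F))

theorem localAt_mul_localAt_le (M : Ideal D) [M.IsPrime] (E F : Submodule D K) :
    localAt M E * localAt M F ≤ localAt M (E * F) := by
  refine Submodule.mul_le.2 ?_
  rintro x ⟨s, hs, hx⟩ y ⟨t, ht, hy⟩
  refine ⟨s * t, Ideal.IsPrime.mul_notMem ‹_› hs ht, ?_⟩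
  rw [← smul_mul_smul_comm]
  exact Submodule.mul_mem_mul hx hy

end Closure

/-! ### `t`-maximal ideals and the local-global principle. -/

section Domain

variable {D K : Type*} [CommRing D] [Field K] [Algebra D K] [IsFractionRing D K]

theorem algebraMap_mem_toK {I : Ideal D} {d : D} : algebraMap D K d ∈ toK K I ↔ d ∈ I := by
  rw [IsLocalization.mem_coeSubmodule]
  exact ⟨fun ⟨y, hy, h⟩ => IsFractionRing.injective D K h ▸ hy, fun h => ⟨d, h, rfl⟩⟩

theorem toK_le_toK {I J : Ideal D} : toK K I ≤ toK K J ↔ I ≤ J :=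
  IsFractionRing.coeSubmodule_le_coeSubmodule

theorem toK_ne_bot {I : Ideal D} (h : I ≠ ⊥) : toK K I ≠ ⊥ := by
  obtain ⟨x, hx, hx0⟩ := Submodule.exists_mem_ne_zero_of_ne_bot h
  refine (Submodule.ne_bot_iff _).2 ⟨algebraMap D K x, algebraMap_mem_toK.2 hx, ?_⟩
  rwa [Ne, IsFractionRing.to_map_eq_zero_iff]

theorem colonElem_ne_bot [IsDomain D] {E : Submodule D K} (hE : E ≠ ⊥) (x : K) :
    colonElem E x ≠ ⊥ := by
  obtain ⟨e, he, he0⟩ := Submodule.exists_mem_ne_zero_of_ne_bot hE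
  obtain ⟨a, b, hb, hab⟩ := IsFractionRing.div_surjective D (e⁻¹ * x)
  have hb' : algebraMap D K b ≠ 0 := IsFractionRing.to_map_ne_zero_of_mem_nonZeroDivisors hb
  refine (Submodule.ne_bot_iff _).2 ⟨b, ?_, nonZeroDivisors.ne_zero hb⟩
  have : b • x = a • e := by
    rw [Algebra.smul_def, Algebra.smul_def]
    field_simp at hab
    linear_combination -hab
  rw [mem_colonElem, this]
  exact E.smul_mem a he

theorem exists_mem_le_of_fg_le_sSup {c : Set (Ideal D)} (hc : IsChain (· ≤ ·) c)
    (hne : c.Nonempty) {F : Submodule D K} (hF : F.FG) (h : F ≤ toK K (sSup c)) :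
    ∃ J ∈ c, F ≤ toK K J := by
  induction F, hF using Submodule.fg_induction with
  | singleton x =>
    obtain ⟨d, hd, rfl⟩ :=
      (IsLocalization.mem_coeSubmodule K _).1 (h (Submodule.mem_span_singleton_self x))
    obtain ⟨J, hJ, hdJ⟩ := (Submodule.mem_sSup_of_directed hne hc.directedOn).1 hd
    exact ⟨J, hJ, (Submodule.span_singleton_le_iff_mem _ _).2 (algebraMap_mem_toK.2 hdJ)⟩
  | sup F₁ F₂ _ _ ih₁ ih₂ =>
    obtain ⟨J₁, hJ₁, h₁⟩ := ih₁ (le_sup_left.trans h)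
    obtain ⟨J₂, hJ₂, h₂⟩ := ih₂ (le_sup_right.trans h)
    rcases hc.total hJ₁ hJ₂ with h' | h'
    · exact ⟨J₂, hJ₂, sup_le (h₁.trans (toK_mono h')) h₂⟩
    · exact ⟨J₁, hJ₁, sup_le h₁ (h₂.trans (toK_mono h'))⟩

/-- The `t`-operation has finite type: a finitely generated `F` inside the union already lies in one
member. This feeds Zorn's lemma. -/
theorem IsTIdeal.sSup_of_isChain {c : Set (Ideal D)} (hc : IsChain (· ≤ ·) c)
    (hne : c.Nonempty) (h : ∀ J ∈ c, IsTIdeal K J) : IsTIdeal K (sSup c) := by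
  obtain ⟨J₀, hJ₀⟩ := hne
  refine ⟨fun h0 => (h J₀ hJ₀).1 (le_bot_iff.1 (h0 ▸ le_sSup hJ₀)), ?_⟩
  refine le_antisymm ?_ (le_tClosure _)
  rintro x ⟨F, hF, hFc, hx⟩
  obtain ⟨J, hJ, hFJ⟩ := exists_mem_le_of_fg_le_sSup hc ⟨J₀, hJ₀⟩ hF hFc
  have : x ∈ toK K J := by
    rw [← (h J hJ).2]
    exact ⟨F, hF, hFJ, hx⟩
  exact toK_mono (le_sSup hJ) this

theorem IsTIdeal.exists_le_isTMaximal {I : Ideal D} (hI : IsTIdeal K I) (h : I ≠ ⊤) :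
    ∃ M, IsTMaximal K M ∧ I ≤ M := by
  have hub : ∀ c ⊆ {J : Ideal D | J ≠ ⊤ ∧ IsTIdeal K J}, IsChain (· ≤ ·) c → ∀ J ∈ c,
      ∃ U ∈ {J : Ideal D | J ≠ ⊤ ∧ IsTIdeal K J}, ∀ J ∈ c, J ≤ U := by
    intro c hcs hc J hJ
    refine ⟨sSup c, ⟨fun htop => ?_, ?_⟩, fun _ => le_sSup⟩
    · obtain ⟨J', hJ', h1⟩ := (Submodule.mem_sSup_of_directed ⟨J, hJ⟩ hc.directedOn).1
        (htop ▸ Submodule.mem_top : (1 : D) ∈ sSup c)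
      exact (hcs hJ').1 ((Ideal.eq_top_iff_one _).2 h1)
    · exact IsTIdeal.sSup_of_isChain hc ⟨J, hJ⟩ fun J hJ => (hcs hJ).2
  obtain ⟨M, hIM, hM⟩ := zorn_le_nonempty₀ _ hub I ⟨h, hI⟩
  exact ⟨M, hM, hIM⟩

/-- For `a ∉ M` the colon ideal `(M : a)` is a proper `t`-ideal containing `M`, hence equal to `M`.
-/
theorem IsTMaximal.isPrime {M : Ideal D} (hM : IsTMaximal K M) : M.IsPrime := by
  refine ⟨hM.prop.1, fun {a b} hab => or_iff_not_imp_left.2 fun ha => ?_⟩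
  have hle : M ≤ colonElem (toK K M) (algebraMap D K a) := fun m hm => by
    rw [mem_colonElem, Algebra.smul_def, ← map_mul, algebraMap_mem_toK]
    exact M.mul_mem_right _ hm
  have hprop : colonElem (toK K M) (algebraMap D K a) ≠ ⊤ ∧
      IsTIdeal K (colonElem (toK K M) (algebraMap D K a)) := by
    refine ⟨fun h => ha ?_, fun h => hM.prop.2.1 (le_bot_iff.1 (h ▸ hle)),
      tClosure_toK_colonElem hM.prop.2.2 _⟩
    have := (Ideal.eq_top_iff_one _).1 h
    rwa [mem_colonElem, one_smul, algebraMap_mem_toK] at this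
  refine hM.le_of_ge hprop hle ?_
  rw [mem_colonElem, Algebra.smul_def, ← map_mul, algebraMap_mem_toK, mul_comm]
  exact hab

theorem IsTMaximal.isTPrime {M : Ideal D} (hM : IsTMaximal K M) : IsTPrime K M :=
  ⟨hM.isPrime, hM.prop.2⟩

/-- A `t`-closed submodule is the intersection of its localizations at the `t`-maximal ideals. -/
theorem mem_of_forall_isTMaximal [IsDomain D] {E : Submodule D K} (hE : tClosure E = E)
    (hE0 : E ≠ ⊥) {x : K} (h : ∀ M : Ideal D, IsTMaximal K M → ∃ s ∉ M, s • x ∈ E) : x ∈ E := by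
  -- The denominators of `x` form a `t`-ideal; if proper, it would lie in some `t`-maximal `M`,
  -- where `h` supplies a denominator outside `M`.
  have hA : IsTIdeal K (colonElem E x) := ⟨colonElem_ne_bot hE0 x, tClosure_toK_colonElem hE x⟩
  by_cases htop : colonElem E x = ⊤
  · simpa [mem_colonElem] using (Ideal.eq_top_iff_one _).1 htop
  · obtain ⟨M, hM, hle⟩ := hA.exists_le_isTMaximal htop
    obtain ⟨s, hs, hx⟩ := h M hM
    exact absurd (hle hx) hs

end Domain

/-! ### Contraction of localized ideals to `D`. -/

section Contraction

variable {D : Type*} [CommRing D]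

/-- The contraction `I D_M ∩ D`. -/
def contractAt (M : Ideal D) [M.IsPrime] (I : Ideal D) : Ideal D where
  carrier := {d | ∃ s ∉ M, s * d ∈ I}
  zero_mem' := ⟨1, M.one_notMem, by simp⟩
  add_mem' := by
    rintro x y ⟨s, hs, hx⟩ ⟨t, ht, hy⟩
    refine ⟨s * t, Ideal.IsPrime.mul_notMem ‹_› hs ht, ?_⟩
    rw [show s * t * (x + y) = t * (s * x) + s * (t * y) by ring]
    exact I.add_mem (I.mul_mem_left _ hx) (I.mul_mem_left _ hy)
  smul_mem' := by
    rintro c x ⟨s, hs, hx⟩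
    refine ⟨s, hs, ?_⟩
    rw [smul_eq_mul, mul_left_comm]
    exact I.mul_mem_left _ hx

theorem mem_contractAt {M : Ideal D} [M.IsPrime] {I : Ideal D} {d : D} :
    d ∈ contractAt M I ↔ ∃ s ∉ M, s * d ∈ I := Iff.rfl

theorem le_contractAt (M : Ideal D) [M.IsPrime] (I : Ideal D) : I ≤ contractAt M I :=
  fun d hd => ⟨1, M.one_notMem, by simpa using hd⟩

theorem contractAt_le {M : Ideal D} [hM : M.IsPrime] {I : Ideal D} (h : I ≤ M) :
    contractAt M I ≤ M := by
  rintro d ⟨s, hs, hd⟩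
  exact (hM.mem_or_mem (h hd)).resolve_left hs

end Contraction

/-! ### Valuation-theoretic behaviour at `t`-primes, and `t`-idempotence. -/

section PvMD

variable {D K : Type*} [CommRing D] [IsDomain D] [Field K] [Algebra D K] [IsFractionRing D K]

/-- In a P`v`MD the localization at a `t`-prime is a valuation ring. -/
theorem IsPvMD.exists_smul_eq_smul (hD : IsPvMD D K) {M : Ideal D} (hM : IsTPrime K M)
    (a b : K) : ∃ s ∉ M, (∃ d : D, s • a = d • b) ∨ ∃ d : D, s • b = d • a := by
  have := hM.1
  by_cases ha : a = 0
  · exact ⟨1, M.one_notMem, .inl ⟨0, by simp [ha]⟩⟩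
  set F : Submodule D K := Submodule.span D {a, b} with hF
  have haF : a ∈ F := Submodule.subset_span (by simp)
  have hbF : b ∈ F := Submodule.subset_span (by simp)
  have hinv := hD F ((Submodule.ne_bot_iff _).2 ⟨a, haF, ha⟩)
    (Submodule.fg_span (Set.toFinite _))
  -- `F F⁻¹ ⊆ M` would give `1 ∈ (F F⁻¹)^t ⊆ M^t = M`.
  have hnot : ¬ F * (1 / F) ≤ toK K M := fun hle => by
    have h1 : (1 : K) ∈ toK K M := by
      rw [← hM.2.2]
      exact tClosure_mono hle (hinv.ge (Submodule.one_le.1 le_rfl))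
    rw [← map_one (algebraMap D K), algebraMap_mem_toK] at h1
    exact M.one_notMem h1
  rw [Submodule.mul_le] at hnot
  push Not at hnot
  obtain ⟨f, hf, g, hg, hfg⟩ := hnot
  rw [Submodule.mem_div_iff_forall_mul_mem] at hg
  obtain ⟨s, hs⟩ := Submodule.mem_one.1 (hg a haF)
  obtain ⟨t, ht⟩ := Submodule.mem_one.1 (hg b hbF)
  obtain ⟨c, d, rfl⟩ := Submodule.mem_span_pair.1 hf
  have hst : c * s + d * t ∉ M := fun h => hfg <| by
    have : (c • a + d • b) * g = algebraMap D K (c * s + d * t) := by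
      rw [map_add, map_mul, map_mul, hs, ht, Algebra.smul_def, Algebra.smul_def]; ring
    rwa [this, algebraMap_mem_toK]
  -- Here `s = ga` and `t = gb`, so `ta = sb`; since `cs + dt ∉ M`, at least one of `s`, `t` is
  -- outside `M`.
  by_cases hsM : s ∈ M
  · refine ⟨t, fun htM => hst (M.add_mem (M.mul_mem_left _ hsM) (M.mul_mem_left _ htM)),
      .inl ⟨s, ?_⟩⟩
    rw [Algebra.smul_def, Algebra.smul_def, hs, ht]; ring
  · refine ⟨s, hsM, .inr ⟨t, ?_⟩⟩
    rw [Algebra.smul_def, Algebra.smul_def, hs, ht]; ring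

/-- Finitely generated modules over a valuation ring are principal, generated by one of the given
generators; a single denominator serves all of `F`. -/
theorem IsPvMD.exists_smul_mem_span_singleton (hD : IsPvMD D K) {M : Ideal D}
    (hM : IsTPrime K M) {F : Submodule D K} (hF : F.FG) :
    ∃ a ∈ F, ∃ s ∉ M, ∀ x ∈ F, s • x ∈ Submodule.span D {a} := by
  have := hM.1
  induction F, hF using Submodule.fg_induction with
  | singleton x =>
    exact ⟨x, Submodule.mem_span_singleton_self x, 1, M.one_notMem, fun y hy => by simpa using hy⟩
  | sup F₁ F₂ _ _ ih₁ ih₂ =>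
    obtain ⟨a₁, ha₁, s₁, hs₁, h₁⟩ := ih₁
    obtain ⟨a₂, ha₂, s₂, hs₂, h₂⟩ := ih₂
    have key : ∃ a ∈ F₁ ⊔ F₂, ∃ s ∉ M, s • a₁ ∈ Submodule.span D {a} ∧
        s • a₂ ∈ Submodule.span D {a} := by
      obtain ⟨s, hs, ⟨d, hd⟩ | ⟨d, hd⟩⟩ := hD.exists_smul_eq_smul hM a₁ a₂
      · exact ⟨a₂, Submodule.mem_sup_right ha₂, s, hs,
          Submodule.mem_span_singleton.2 ⟨d, hd.symm⟩, Submodule.mem_span_singleton.2 ⟨s, rfl⟩⟩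
      · exact ⟨a₁, Submodule.mem_sup_left ha₁, s, hs,
          Submodule.mem_span_singleton.2 ⟨s, rfl⟩, Submodule.mem_span_singleton.2 ⟨d, hd.symm⟩⟩
    obtain ⟨a, ha, s, hs, hsa₁, hsa₂⟩ := key
    refine ⟨a, ha, s * s₁ * s₂, Ideal.IsPrime.mul_notMem this
      (Ideal.IsPrime.mul_notMem this hs hs₁) hs₂, fun x hx => ?_⟩
    obtain ⟨x₁, hx₁, x₂, hx₂, rfl⟩ := Submodule.mem_sup.1 hx
    obtain ⟨c₁, hc₁⟩ := Submodule.mem_span_singleton.1 (h₁ x₁ hx₁)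
    obtain ⟨c₂, hc₂⟩ := Submodule.mem_span_singleton.1 (h₂ x₂ hx₂)
    have : (s * s₁ * s₂) • (x₁ + x₂) = (s₂ * c₁) • s • a₁ + (s₁ * c₂) • s • a₂ := by
      rw [smul_add, mul_smul s₂, smul_comm c₁, hc₁, mul_smul s₁, smul_comm c₂, hc₂]
      simp only [← mul_smul]
      congr 2 <;> ring
    rw [this]
    exact Submodule.add_mem _ (Submodule.smul_mem _ _ hsa₁) (Submodule.smul_mem _ _ hsa₂)

/-- In a P`v`MD the `t`-closure does not change localizations at `t`-primes. -/
theorem IsPvMD.tClosure_le_localAt (hD : IsPvMD D K) {M : Ideal D} [M.IsPrime]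
    (hM : IsTPrime K M) {E : Submodule D K} (hE : E ≠ ⊥) : tClosure E ≤ localAt M E := by
  rintro x ⟨F, hF, hFE, hx⟩
  obtain ⟨e, he, he0⟩ := Submodule.exists_mem_ne_zero_of_ne_bot hE
  -- Adjoining a nonzero `e ∈ E` makes the local generator `a` nonzero. Then `s a⁻¹` lies in the
  -- inverse module, so `s a⁻¹ x ∈ D` and `sx ∈ aD ⊆ E`.
  replace hx := vClosure_mono (le_sup_left : F ≤ F ⊔ Submodule.span D {e}) hx
  obtain ⟨a, ha, s, hs, h⟩ :=
    hD.exists_smul_mem_span_singleton hM (hF.sup (Submodule.fg_span_singleton e))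
  have hs0 : algebraMap D K s ≠ 0 := by
    rw [Ne, IsFractionRing.to_map_eq_zero_iff]
    rintro rfl
    exact hs M.zero_mem
  have ha0 : a ≠ 0 := by
    rintro rfl
    have := h e (Submodule.mem_sup_right (Submodule.mem_span_singleton_self e))
    rw [Submodule.span_zero_singleton, Submodule.mem_bot, Algebra.smul_def] at this
    exact mul_ne_zero hs0 he0 this
  have hinv : s • a⁻¹ ∈ 1 / (F ⊔ Submodule.span D {e}) := by
    rw [Submodule.mem_div_iff_forall_mul_mem]
    intro y hy
    obtain ⟨c, hc⟩ := Submodule.mem_span_singleton.1 (h y hy)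
    refine Submodule.mem_one.2 ⟨c, ?_⟩
    rw [Algebra.smul_def, Algebra.smul_def] at hc
    rw [Algebra.smul_def]
    field_simp
    linear_combination hc
  obtain ⟨d, hd⟩ := Submodule.mem_one.1 (Submodule.mem_div_iff_forall_mul_mem.1 hx _ hinv)
  have hle : F ⊔ Submodule.span D {e} ≤ E :=
    sup_le hFE ((Submodule.span_singleton_le_iff_mem _ _).2 he)
  refine ⟨s, hs, ?_⟩
  have : s • x = d • a := by
    rw [Algebra.smul_def, Algebra.smul_def, hd, Algebra.smul_def]
    field_simp
  rw [this]
  exact E.smul_mem d (hle ha)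

theorem mem_tClosure_of_forall_isTMaximal {E : Submodule D K} (hE : E ≠ ⊥) {x : K}
    (h : ∀ M : Ideal D, IsTMaximal K M → ∃ s ∉ M, s • x ∈ E) : x ∈ tClosure E := by
  refine mem_of_forall_isTMaximal (tClosure_tClosure E)
    (fun h0 => hE (le_bot_iff.1 (h0 ▸ le_tClosure E))) fun M hM => ?_
  obtain ⟨s, hs, hx⟩ := h M hM
  exact ⟨s, hs, le_tClosure _ hx⟩

/-- In the valuation ring `D_M`, an element `a` outside `E_M` divides every element of `E_M` with
non-unit quotient. -/
theorem IsPvMD.le_localAt_span_mul_of_notMem (hD : IsPvMD D K) {M : Ideal D} [M.IsPrime]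
    (hM : IsTPrime K M) {E : Submodule D K} {a : K} (ha : a ∉ localAt M E) :
    E ≤ localAt M (Submodule.span D {a} * toK K M) := by
  intro e he
  obtain ⟨s, hs, ⟨d, hd⟩ | ⟨d, hd⟩⟩ := hD.exists_smul_eq_smul hM a e
  · exact absurd ⟨s, hs, hd ▸ E.smul_mem d he⟩ ha
  · have hdM : d ∈ M := by
      by_contra hdM
      exact ha ⟨d, hdM, hd ▸ E.smul_mem s he⟩
    refine ⟨s, hs, Submodule.mem_span_singleton_mul.2 ⟨algebraMap D K d,
      algebraMap_mem_toK.2 hdM, ?_⟩⟩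
    rw [hd, Algebra.smul_def, mul_comm]

/-- In `D_M` every `q ∈ Q` is a multiple of `b`, since otherwise `b ∈ Q`; primeness then puts the
quotient in `Q`. Thus `Q_M = b Q_M`. -/
theorem IsPvMD.toK_le_localAt_span_mul (hD : IsPvMD D K) {M : Ideal D} [M.IsPrime]
    (hM : IsTPrime K M) {Q : Ideal D} (hQ : Q.IsPrime) (hQM : Q ≤ M) {b : D} (hb : b ∉ Q) :
    toK K Q ≤ localAt M (Submodule.span D {algebraMap D K b} * toK K Q) := by
  intro x hx
  obtain ⟨q, hq, rfl⟩ := (IsLocalization.mem_coeSubmodule K _).1 hx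
  obtain ⟨s, hs, ⟨d, hd⟩ | ⟨d, hd⟩⟩ :=
    hD.exists_smul_eq_smul hM (algebraMap D K q) (algebraMap D K b)
  · have hd' : s * q = d * b := by
      apply IsFractionRing.injective D K
      simpa [Algebra.smul_def] using hd
    have hdQ : d ∈ Q := (hQ.mem_or_mem (hd' ▸ Q.mul_mem_left s hq)).resolve_right hb
    refine ⟨s, hs, Submodule.mem_span_singleton_mul.2 ⟨algebraMap D K d,
      algebraMap_mem_toK.2 hdQ, ?_⟩⟩
    rw [hd, Algebra.smul_def, mul_comm]
  · have hd' : s * b = d * q := by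
      apply IsFractionRing.injective D K
      simpa [Algebra.smul_def] using hd
    rcases hQ.mem_or_mem (hd' ▸ Q.mul_mem_left d hq : s * b ∈ Q) with h | h
    · exact absurd (hQM h) hs
    · exact absurd h hb

theorem IsPvMD.le_or_le_of_isPrime (hD : IsPvMD D K) {M : Ideal D} (hM : IsTPrime K M)
    {P Q : Ideal D} (hP : P.IsPrime) (hQ : Q.IsPrime) (hPM : P ≤ M) (hQM : Q ≤ M) :
    P ≤ Q ∨ Q ≤ P := by
  have := hM.1
  refine or_iff_not_imp_left.2 fun h q hq => ?_
  obtain ⟨b, hbP, hbQ⟩ := SetLike.not_le_iff_exists.1 h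
  obtain ⟨s, hs, hx⟩ :=
    hD.toK_le_localAt_span_mul hM hQ hQM hbQ (algebraMap_mem_toK.2 hq)
  obtain ⟨z, hz, hzq⟩ := Submodule.mem_span_singleton_mul.1 hx
  obtain ⟨d, -, rfl⟩ := (IsLocalization.mem_coeSubmodule K _).1 hz
  have hd : b * d = s * q := by
    apply IsFractionRing.injective D K
    simpa [Algebra.smul_def] using hzq
  exact (hP.mem_or_mem (hd ▸ P.mul_mem_right d hbP : s * q ∈ P)).resolve_left
    fun h => hs (hPM h)

theorem IsTIdempotent.toK_le_localAt (hD : IsPvMD D K) {I : Ideal D} (hI0 : I ≠ ⊥)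
    (hI : IsTIdempotent K I) {M : Ideal D} [M.IsPrime] (hM : IsTPrime K M) :
    toK K I ≤ localAt M (toK K (I ^ 2)) := by
  refine (le_tClosure _).trans ?_
  rw [hI]
  exact hD.tClosure_le_localAt hM (toK_ne_bot (pow_ne_zero 2 hI0))

theorem isTIdempotent_of_forall_isTMaximal {I : Ideal D} (hI0 : I ≠ ⊥)
    (h : ∀ M : Ideal D, IsTMaximal K M → ∀ x ∈ toK K I, ∃ s ∉ M, s • x ∈ toK K (I ^ 2)) :
    IsTIdempotent K I := by
  refine le_antisymm ?_ (tClosure_mono (toK_mono (Ideal.pow_le_self two_ne_zero)))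
  rw [← tClosure_tClosure (toK K (I ^ 2))]
  exact tClosure_mono fun x hx => mem_tClosure_of_forall_isTMaximal
    (toK_ne_bot (pow_ne_zero 2 hI0)) fun M hM => h M hM x hx

theorem mem_contractAt_iff_mem_localAt {M : Ideal D} [M.IsPrime] {I : Ideal D} {d : D} :
    d ∈ contractAt M I ↔ algebraMap D K d ∈ localAt M (toK K I) := by
  simp only [mem_contractAt, mem_localAt, Algebra.smul_def, ← map_mul, algebraMap_mem_toK]

theorem toK_contractAt_le (M : Ideal D) [M.IsPrime] (I : Ideal D) :
    toK K (contractAt M I) ≤ localAt M (toK K I) := by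
  intro x hx
  obtain ⟨d, hd, rfl⟩ := (IsLocalization.mem_coeSubmodule K _).1 hx
  exact mem_contractAt_iff_mem_localAt.1 hd

theorem IsPvMD.isTIdeal_contractAt (hD : IsPvMD D K) {M : Ideal D} [M.IsPrime]
    (hM : IsTPrime K M) {I : Ideal D} (hI0 : I ≠ ⊥) : IsTIdeal K (contractAt M I) := by
  have h0 : contractAt M I ≠ ⊥ := fun h => hI0 (le_bot_iff.1 (h ▸ le_contractAt M I))
  refine ⟨h0, tClosure_toK_eq_of_forall fun d hd => ?_⟩
  rw [mem_contractAt_iff_mem_localAt (K := K)]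
  exact localAt_le_localAt (toK_contractAt_le M I)
    (hD.tClosure_le_localAt hM (toK_ne_bot h0) hd)

/-- If `ab ∈ I_M` but `a, b ∉ I_M`, then `I_M ⊆ aM_M` and `I_M ⊆ bM_M`, so `ab ∈ I_M = I_M² ⊆
abM_M`; cancelling `ab` puts a unit in `M_M`. -/
theorem IsTIdempotent.isPrime_contractAt (hD : IsPvMD D K) {M : Ideal D} [M.IsPrime]
    (hM : IsTPrime K M) {I : Ideal D} (hI0 : I ≠ ⊥) (hI : IsTIdempotent K I) (hIM : I ≤ M) :
    (contractAt M I).IsPrime := by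
  refine ⟨fun h => M.one_notMem (contractAt_le hIM (h ▸ Submodule.mem_top)), fun {a b} hab => ?_⟩
  by_contra! hcon
  simp only [mem_contractAt_iff_mem_localAt (K := K)] at hab hcon
  have hab2 := localAt_le_localAt (hI.toK_le_localAt hD hI0 hM) hab
  rw [toK_pow_two] at hab2
  have hle := (mul_le_mul' (hD.le_localAt_span_mul_of_notMem hM hcon.1)
    (hD.le_localAt_span_mul_of_notMem hM hcon.2)).trans (localAt_mul_localAt_le M _ _)
  obtain ⟨s, hs, hx⟩ := localAt_le_localAt hle hab2
  rw [mul_mul_mul_comm, Submodule.span_mul_span, Set.singleton_mul_singleton, ← toK_mul] at hx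
  obtain ⟨z, hz, hzx⟩ := Submodule.mem_span_singleton_mul.1 hx
  obtain ⟨m, hm, rfl⟩ := (IsLocalization.mem_coeSubmodule K _).1 hz
  have hmM : m ∈ M := Ideal.mul_le_left hm
  have hne : a * b ≠ 0 := by
    intro h0
    rcases mul_eq_zero.1 h0 with h | h
    · exact hcon.1 (by simp [h])
    · exact hcon.2 (by simp [h])
  have : a * b * m = a * b * s := by
    apply IsFractionRing.injective D K
    simpa [Algebra.smul_def, mul_comm, mul_left_comm] using hzx
  exact hs (mul_left_cancel₀ hne this ▸ hmM)

/-- Idempotence is inherited from `I` only at `M`. At another `t`-maximal `N ⊇ Q`, a denominator `t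
∉ M` is outside `Q`, so `Q_N = tQ_N` and `t` can be cancelled from `tx ∈ Q²`. -/
theorem IsTIdempotent.contractAt (hD : IsPvMD D K) {M : Ideal D} [M.IsPrime]
    (hM : IsTPrime K M) {I : Ideal D} (hI0 : I ≠ ⊥) (hI : IsTIdempotent K I) (hIM : I ≤ M) :
    IsTIdempotent K (contractAt M I) := by
  have hQ := hI.isPrime_contractAt hD hM hI0 hIM
  have hQt := hD.isTIdeal_contractAt hM hI0
  set Q := StarOp.contractAt M I with hQdef
  refine isTIdempotent_of_forall_isTMaximal hQt.1 fun N hN x hx => ?_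
  have := hN.isPrime
  by_cases hQN : Q ≤ N
  · obtain ⟨t, htM, ht⟩ := localAt_le_localAt (hI.toK_le_localAt hD hI0 hM)
      (toK_contractAt_le M I hx)
    have htQ : t ∉ Q := fun h => htM (contractAt_le hIM h)
    replace ht := toK_mono (Ideal.pow_right_mono (le_contractAt M I) 2) ht
    rw [← hQdef, toK_pow_two] at ht
    have hle : toK K Q * toK K Q ≤
        localAt N (Submodule.span D {algebraMap D K t} * toK K (Q ^ 2)) := by
      refine (mul_le_mul' (hD.toK_le_localAt_span_mul hN.isTPrime hQ hQN htQ)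
        (le_localAt N (toK K Q))).trans ((localAt_mul_localAt_le N _ _).trans ?_)
      rw [mul_assoc, toK_pow_two]
    obtain ⟨s, hs, hst⟩ := hle ht
    obtain ⟨z, hz, hzx⟩ := Submodule.mem_span_singleton_mul.1 hst
    have ht0 : algebraMap D K t ≠ 0 := by
      rw [Ne, IsFractionRing.to_map_eq_zero_iff]
      rintro rfl
      exact htM M.zero_mem
    have : s • x = z := by
      rw [smul_comm, Algebra.smul_def t] at hzx
      exact (mul_left_cancel₀ ht0 hzx).symm
    exact ⟨s, hs, this ▸ hz⟩
  · obtain ⟨s, hsQ, hsN⟩ := SetLike.not_le_iff_exists.1 hQN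
    refine ⟨s, hsN, ?_⟩
    rw [toK_pow_two, Algebra.smul_def]
    exact Submodule.mul_mem_mul (algebraMap_mem_toK.2 hsQ) hx

end PvMD

/-! ### `t`-products as intersections, and the decomposition of `t`-idempotent ideals. -/

section TProduct

variable {D K : Type*} [CommRing D] [IsDomain D] [Field K] [Algebra D K] [IsFractionRing D K]

theorem Incomparable.eq_of_le {s : Multiset (Ideal D)} (hs : Incomparable s) {P Q : Ideal D}
    (hP : P ∈ s) (hQ : Q ∈ s) (h : P ≤ Q) : P = Q := by
  by_contra hne
  exact hs.2 P hP Q hQ hne h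

theorem IsTIdeal.tClosure_toK_le {I J : Ideal D} (hI : IsTIdeal K I) (h : J ≤ I) :
    tClosure (toK K J) ≤ toK K I :=
  (tClosure_mono (toK_mono h)).trans hI.2.le

theorem multiset_prod_ne_bot {s : Multiset (Ideal D)} (h : ∀ P ∈ s, IsTPrime K P) :
    s.prod ≠ ⊥ :=
  Multiset.prod_ne_zero fun h0 => (h _ h0).2.1 rfl

/-- Pairwise incomparable `t`-primes of a P`v`MD: at most one of them lies in a given
`t`-maximal ideal. -/
theorem IsPvMD.not_prod_erase_le (hD : IsPvMD D K) {s : Multiset (Ideal D)}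
    (hs : Incomparable s) (h : ∀ P ∈ s, IsTPrime K P) {M P : Ideal D} (hM : IsTPrime K M)
    (hP : P ∈ s) (hPM : P ≤ M) [DecidableEq (Ideal D)] : ¬ (s.erase P).prod ≤ M := by
  intro hle
  obtain ⟨Q, hQ, hQM⟩ := hM.1.multiset_prod_le.1 hle
  have hQs := Multiset.mem_of_mem_erase hQ
  have hPQ : P = Q := by
    rcases hD.le_or_le_of_isPrime hM (h P hP).1 (h Q hQs).1 hPM hQM with h' | h'
    · exact hs.eq_of_le hP hQs h'
    · exact (hs.eq_of_le hQs hP h').symm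
  exact hs.1.notMem_erase (hPQ ▸ hQ)

theorem IsPvMD.tClosure_toK_prod (hD : IsPvMD D K) {s : Multiset (Ideal D)}
    (hs : Incomparable s) (h : ∀ P ∈ s, IsTPrime K P) :
    tClosure (toK K s.prod) = toK K s.inf := by
  classical
  refine le_antisymm (fun x hx => ?_) (fun x hx => ?_)
  · obtain ⟨d, rfl⟩ := Submodule.mem_one.1 (tClosure_toK_le_one _ hx)
    have : Ideal.span {d} ≤ s.inf := Multiset.le_inf.2 fun P hP => by
      rw [Ideal.span_singleton_le_iff_mem, ← algebraMap_mem_toK (K := K)]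
      exact (h P hP).2.tClosure_toK_le
        (Ideal.multiset_prod_le_inf.trans (Multiset.inf_le hP)) hx
    exact algebraMap_mem_toK.2 ((Ideal.span_singleton_le_iff_mem _).1 this)
  · obtain ⟨d, hd, rfl⟩ := (IsLocalization.mem_coeSubmodule K _).1 hx
    refine mem_tClosure_of_forall_isTMaximal (toK_ne_bot (multiset_prod_ne_bot h))
      fun M hM => ?_
    simp only [Algebra.smul_def, ← map_mul, algebraMap_mem_toK]
    by_cases hsM : s.prod ≤ M
    · obtain ⟨P, hP, hPM⟩ := hM.isPrime.multiset_prod_le.1 hsM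
      obtain ⟨u, hu, huM⟩ :=
        -- The product of the other factors is not contained in `M`, so it supplies a denominator `u
        -- ∉ M` with `ud ∈ P · ∏(others)`.
        SetLike.not_le_iff_exists.1 (hD.not_prod_erase_le hs h hM.isTPrime hP hPM)
      refine ⟨u, huM, ?_⟩
      rw [mul_comm u, ← Multiset.cons_erase hP, Multiset.prod_cons]
      exact Ideal.mul_mem_mul (Multiset.inf_le hP hd) hu
    · obtain ⟨u, hu, huM⟩ := SetLike.not_le_iff_exists.1 hsM
      exact ⟨u, huM, Ideal.mul_mem_right _ _ hu⟩

theorem IsPvMD.isTProduct_iff_eq_inf (hD : IsPvMD D K) {I : Ideal D} {s : Multiset (Ideal D)}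
    (hs : Incomparable s) (h : ∀ P ∈ s, IsTPrime K P) : IsTProduct K I s ↔ I = s.inf := by
  rw [IsTProduct, hD.tClosure_toK_prod hs h]
  refine ⟨fun h => le_antisymm (toK_le_toK.1 h.le) (toK_le_toK.1 h.ge), fun h => by rw [h]⟩

theorem IsTProduct.prod_le {I : Ideal D} {s : Multiset (Ideal D)} (h : IsTProduct K I s) :
    s.prod ≤ I := by
  rw [← toK_le_toK (K := K), h]
  exact le_tClosure _

theorem IsTProduct.le_of_mem {I P : Ideal D} {s : Multiset (Ideal D)} (h : IsTProduct K I s)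
    (hP : P ∈ s) (hPt : IsTIdeal K P) : I ≤ P := by
  rw [← toK_le_toK (K := K), h]
  exact hPt.tClosure_toK_le (Ideal.multiset_prod_le_inf.trans (Multiset.inf_le hP))

theorem IsTIdempotent.mul (hD : IsPvMD D K) {I J : Ideal D} (hI0 : I ≠ ⊥) (hJ0 : J ≠ ⊥)
    (hI : IsTIdempotent K I) (hJ : IsTIdempotent K J) : IsTIdempotent K (I * J) := by
  refine isTIdempotent_of_forall_isTMaximal (mul_ne_zero hI0 hJ0) fun M hM x hx => ?_
  have := hM.isPrime
  rw [toK_mul] at hx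
  have := localAt_mul_localAt_le M _ _ (mul_le_mul' (hI.toK_le_localAt hD hI0 hM.isTPrime)
    (hJ.toK_le_localAt hD hJ0 hM.isTPrime) hx)
  rwa [← toK_mul, ← mul_pow] at this

theorem isTIdempotent_multiset_prod (hD : IsPvMD D K) {s : Multiset (Ideal D)}
    (h : ∀ P ∈ s, IsTPrime K P ∧ IsTIdempotent K P) : IsTIdempotent K s.prod := by
  induction s using Multiset.induction with
  | empty => rw [Multiset.prod_zero, IsTIdempotent, one_pow]
  | cons P s ih =>
    have hs : ∀ Q ∈ s, IsTPrime K Q ∧ IsTIdempotent K Q :=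
      fun Q hQ => h Q (Multiset.mem_cons_of_mem hQ)
    have hP := h P (Multiset.mem_cons_self P s)
    rw [Multiset.prod_cons]
    exact hP.2.mul hD hP.1.2.1 (multiset_prod_ne_bot fun Q hQ => (hs Q hQ).1) (ih hs)

theorem IsTProduct.isTIdempotent (hD : IsPvMD D K) {I : Ideal D} {s : Multiset (Ideal D)}
    (h : ∀ P ∈ s, IsTPrime K P ∧ IsTIdempotent K P) (hI : IsTProduct K I s) :
    IsTIdempotent K I := by
  refine le_antisymm ?_ (tClosure_mono (toK_mono (Ideal.pow_le_self two_ne_zero)))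
  rw [hI, tClosure_tClosure, isTIdempotent_multiset_prod hD h]
  exact tClosure_mono (toK_mono (Ideal.pow_right_mono hI.prod_le 2))

theorem HasFiniteTCharacter.finite_isTMaximal_ge (hfc : HasFiniteTCharacter D K) {I : Ideal D}
    (hI0 : I ≠ ⊥) : {M : Ideal D | IsTMaximal K M ∧ I ≤ M}.Finite := by
  obtain ⟨x, hx, hx0⟩ := Submodule.exists_mem_ne_zero_of_ne_bot hI0
  exact (hfc x hx0).subset fun M hM => ⟨hM.1, hM.2 hx⟩

/-- A `t`-idempotent `t`-ideal of a P`v`MD of finite `t`-character is a `t`-product of pairwise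
incomparable `t`-idempotent `t`-primes. -/
theorem IsTIdempotent.exists_incomparable_isTProduct (hD : IsPvMD D K)
    (hfc : HasFiniteTCharacter D K) {I : Ideal D} (hI : IsTIdeal K I)
    (hidem : IsTIdempotent K I) :
    ∃ s : Multiset (Ideal D), (∀ P ∈ s, IsTPrime K P ∧ IsTIdempotent K P) ∧
      Incomparable s ∧ IsTProduct K I s := by
  let T := {M : Ideal D | IsTMaximal K M ∧ I ≤ M}
  have : Finite T := hfc.finite_isTMaximal_ge hI.1
  let f : T → Ideal D := fun M => have := M.2.1.isPrime; StarOp.contractAt M.1 I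
  -- Discarding the non-minimal contractions gives incomparability without changing the
  -- intersection.
  have hmin := (Set.finite_range f).subset
    (fun Q (hQ : Q ∈ {Q | Minimal (· ∈ Set.range f) Q}) => hQ.prop)
  have hmem : ∀ {Q}, Q ∈ hmin.toFinset.val ↔ Minimal (· ∈ Set.range f) Q := by
    intro Q
    rw [Finset.mem_val, Set.Finite.mem_toFinset]
    rfl
  have hprime : ∀ Q ∈ hmin.toFinset.val, IsTPrime K Q ∧ IsTIdempotent K Q := by
    intro Q hQ
    obtain ⟨⟨M, hM, hIM⟩, rfl⟩ := (hmem.1 hQ).prop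
    have := hM.isPrime
    exact ⟨⟨hidem.isPrime_contractAt hD hM.isTPrime hI.1 hIM,
      hD.isTIdeal_contractAt hM.isTPrime hI.1⟩, hidem.contractAt hD hM.isTPrime hI.1 hIM⟩
  have hinc : Incomparable hmin.toFinset.val := by
    refine ⟨Finset.nodup _, fun P hP Q hQ hne hle => hne ?_⟩
    exact le_antisymm hle ((hmem.1 hQ).le_of_le (hmem.1 hP).prop hle)
  refine ⟨_, hprime, hinc,
    (hD.isTProduct_iff_eq_inf hinc fun P hP => (hprime P hP).1).2 (le_antisymm ?_ ?_)⟩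
  · refine Multiset.le_inf.2 fun Q hQ => ?_
    obtain ⟨⟨M, hM, hIM⟩, rfl⟩ := (hmem.1 hQ).prop
    have := hM.isPrime
    exact le_contractAt M I
  · intro d hd
    rw [← algebraMap_mem_toK (K := K)]
    refine mem_of_forall_isTMaximal hI.2 (toK_ne_bot hI.1) fun M hM => ?_
    simp only [Algebra.smul_def, ← map_mul, algebraMap_mem_toK]
    by_cases hIM : I ≤ M
    · obtain ⟨Q, hQM, hQ⟩ :=
        (Set.finite_range f).exists_le_minimal (Set.mem_range_self (⟨M, hM, hIM⟩ : T))
      exact hQM (Multiset.inf_le (hmem.2 hQ) hd)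
    · obtain ⟨u, hu, huM⟩ := SetLike.not_le_iff_exists.1 hIM
      exact ⟨u, huM, I.mul_mem_right d hu⟩

end TProduct

/-! ### Divisorial `t`-primes and uniqueness of the factors. -/

section Divisorial

variable {D K : Type*} [CommRing D] [IsDomain D] [Field K] [Algebra D K] [IsFractionRing D K]

/-- For `y ∈ M⁻¹` outside `D`, integrality can fail only at `M`, so `dy = s` with `d ∈ M`, `s ∉ M`.
Idempotence gives `td ∈ M²` with `t ∉ M`, and `yM² ⊆ M` forces `ts ∈ M`. -/
theorem IsTMaximal.one_div_le_one (hD : IsPvMD D K) {M : Ideal D} (hM : IsTMaximal K M)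
    (hidem : IsTIdempotent K M) : 1 / toK K M ≤ 1 := by
  have := hM.isPrime
  intro y hy
  by_contra hy1
  rw [Submodule.mem_div_iff_forall_mul_mem] at hy
  have hloc : y ∉ localAt M (1 : Submodule D K) := by
    rintro ⟨s, hs, hsy⟩
    refine hy1 (mem_of_forall_isTMaximal tClosure_one
      ((Submodule.ne_bot_iff _).2 ⟨1, Submodule.one_le.1 le_rfl, one_ne_zero⟩) fun N hN => ?_)
    by_cases hMN : M ≤ N
    · exact ⟨s, fun h => hs (hM.le_of_ge hN.prop hMN h), hsy⟩
    · obtain ⟨u, hu, huN⟩ := SetLike.not_le_iff_exists.1 hMN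
      refine ⟨u, huN, ?_⟩
      rw [Algebra.smul_def, mul_comm]
      exact hy _ (algebraMap_mem_toK.2 hu)
  obtain ⟨s, hs, ⟨d, hd⟩ | ⟨d, hd⟩⟩ := hD.exists_smul_eq_smul hM.isTPrime y 1
  · exact hloc ⟨s, hs, hd ▸ Submodule.smul_mem _ d (Submodule.one_le.1 le_rfl)⟩
  · have hdM : d ∈ M := by
      by_contra hdM
      exact hloc ⟨d, hdM, hd ▸ Submodule.smul_mem _ s (Submodule.one_le.1 le_rfl)⟩
    obtain ⟨t, ht, htd⟩ := hidem.toK_le_localAt hD hM.prop.2.1 hM.isTPrime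
      (algebraMap_mem_toK.2 hdM)
    have hle : Submodule.span D {y} * toK K (M ^ 2) ≤ toK K M := by
      rw [toK_pow_two, ← mul_assoc]
      refine (mul_le_mul_left ?_ _).trans (one_mul _).le
      refine Submodule.mul_le.2 fun z hz m hm => ?_
      obtain ⟨c, rfl⟩ := Submodule.mem_span_singleton.1 hz
      rw [smul_mul_assoc]
      exact Submodule.smul_mem _ c (hy m hm)
    have hmem := hle (Submodule.mul_mem_mul (Submodule.mem_span_singleton_self y) htd)
    have hts : y * t • algebraMap D K d = algebraMap D K (t * s) := by
      simp only [Algebra.smul_def, mul_one] at hd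
      rw [Algebra.smul_def, map_mul, hd]; ring
    rw [hts, algebraMap_mem_toK] at hmem
    exact Ideal.IsPrime.mul_notMem this ht hs hmem

/-- If `I` is divisorial, none of the incomparable `t`-idempotent `t`-prime factors of `I` is
`t`-maximal. -/
theorem IsDivisorial.not_isTMaximal_of_mem (hD : IsPvMD D K) {I : Ideal D}
    (hdiv : IsDivisorial K I) {s : Multiset (Ideal D)}
    (h : ∀ P ∈ s, IsTPrime K P ∧ IsTIdempotent K P) (hs : Incomparable s)
    (hI : IsTProduct K I s) {M : Ideal D} (hMs : M ∈ s) : ¬ IsTMaximal K M := by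
  classical
  intro hM
  obtain ⟨j, hj, hjM⟩ := SetLike.not_le_iff_exists.1
    (hD.not_prod_erase_le hs (fun P hP => (h P hP).1) hM.isTPrime hMs le_rfl)
  refine hjM (hI.le_of_mem hMs hM.prop.2 ?_)
  -- It suffices that `j ∈ I^v`: for `y ∈ I⁻¹`, `jyM ⊆ yI ⊆ D`, so `jy ∈ M⁻¹ ⊆ D`.
  rw [← algebraMap_mem_toK (K := K), ← hdiv, vClosure, Submodule.mem_div_iff_forall_mul_mem]
  intro y hy
  refine hM.one_div_le_one hD (h M hMs).2 ?_
  rw [Submodule.mem_div_iff_forall_mul_mem] at hy ⊢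
  intro z hz
  obtain ⟨m, hm, rfl⟩ := (IsLocalization.mem_coeSubmodule K _).1 hz
  have hmj : m * j ∈ I := by
    refine hI.prod_le ?_
    rw [← Multiset.cons_erase hMs, Multiset.prod_cons]
    exact Ideal.mul_mem_mul hm hj
  rw [mul_comm _ y, mul_assoc, ← map_mul, mul_comm j]
  exact hy _ (algebraMap_mem_toK.2 hmj)

theorem IsTPrime.exists_notMem_forall_isTMaximal (hfc : HasFiniteTCharacter D K) {P : Ideal D}
    (hP : IsTPrime K P) (hmax : ¬ IsTMaximal K P) :
    ∃ a ∉ P, ∀ M, IsTMaximal K M → P ≤ M → a ∈ M := by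
  have hex : ∀ M, IsTMaximal K M → ∃ c ∈ M, c ∉ P := by
    refine fun M hM => SetLike.not_le_iff_exists.1 fun hle => hmax ?_
    rwa [← hM.eq_of_le ⟨hP.1.ne_top, hP.2⟩ hle]
  choose! c hcM hcP using hex
  have hfin := hfc.finite_isTMaximal_ge hP.2.1
  refine ⟨∏ M ∈ hfin.toFinset, c M, fun hmem => ?_, fun M hM hPM => ?_⟩
  · obtain ⟨M, hM, hc⟩ := (hP.1.prod_mem_iff).1 hmem
    exact hcP M ((Set.Finite.mem_toFinset _).1 hM).1 hc
  · exact Ideal.mem_of_dvd M (Finset.dvd_prod_of_mem c ((Set.Finite.mem_toFinset _).2 ⟨hM, hPM⟩))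
      (hcM M hM)

/-- Start with a nonzero `p ∈ I`; for each of the finitely many `t`-maximal `M ∋ p` not containing
`I`, add an element of `I` outside `M`. -/
theorem exists_fg_le_forall_isTMaximal (hfc : HasFiniteTCharacter D K) {I : Ideal D}
    (hI0 : I ≠ ⊥) : ∃ F : Ideal D, F.FG ∧ F ≤ I ∧ F ≠ ⊥ ∧
      ∀ M, IsTMaximal K M → F ≤ M → I ≤ M := by
  obtain ⟨p, hp, hp0⟩ := Submodule.exists_mem_ne_zero_of_ne_bot hI0
  have hex : ∀ M : Ideal D, ∃ e ∈ I, ¬ I ≤ M → e ∉ M := fun M => by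
    by_cases h : I ≤ M
    · exact ⟨p, hp, fun h' => absurd h h'⟩
    · obtain ⟨e, he, heM⟩ := SetLike.not_le_iff_exists.1 h
      exact ⟨e, he, fun _ => heM⟩
  choose e heI heM using hex
  have hfin := ((hfc p hp0).image e).insert p
  have hpF : p ∈ Ideal.span (insert p (e '' {M | IsTMaximal K M ∧ p ∈ M})) :=
    Ideal.subset_span (Set.mem_insert _ _)
  refine ⟨_, Submodule.fg_span hfin, Ideal.span_le.2 ?_,
    (Submodule.ne_bot_iff _).2 ⟨p, hpF, hp0⟩, fun M hM hle => ?_⟩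
  · rintro x (rfl | ⟨M, -, rfl⟩)
    · exact hp
    · exact heI M
  · by_contra hIM
    exact heM M hIM (hle (Ideal.subset_span
      (Set.mem_insert_of_mem _ (Set.mem_image_of_mem e ⟨hM, hle hpF⟩))))

/-- In a P`v`MD of finite `t`-character every `t`-prime that is not `t`-maximal is divisorial. -/
theorem IsTPrime.isDivisorial (hD : IsPvMD D K) (hfc : HasFiniteTCharacter D K) {P : Ideal D}
    (hP : IsTPrime K P) (hmax : ¬ IsTMaximal K P) : IsDivisorial K P := by
  refine le_antisymm (fun x hx => ?_) (le_vClosure _)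
  have hx1 := vClosure_mono (toK_le_one P) hx
  rw [vClosure_one] at hx1
  obtain ⟨d, rfl⟩ := Submodule.mem_one.1 hx1
  rw [algebraMap_mem_toK]
  by_contra hdP
  obtain ⟨a, haP, ha⟩ := hP.exists_notMem_forall_isTMaximal hfc hmax
  obtain ⟨F, hF, hFP, hF0, hFM⟩ := exists_fg_le_forall_isTMaximal hfc hP.2.1
  -- The factor `a` makes `b` a proper multiple of `d` in `D_M` for every `t`-maximal `M ⊇ P`, while
  -- `b ∉ P` still divides all of `P` there. So `P ⊆ J^t`, whence `d ∈ P^v ⊆ J^v = J^t`, yet `J_M =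
  -- bD_M` omits `d`.
  set b := a * d ^ 2 with hb
  have hbP : b ∉ P := hP.1.mul_notMem haP fun h => hdP (hP.1.mem_of_pow_mem 2 h)
  set J := F ⊔ Ideal.span {b} with hJ
  have hbJ : b ∈ J := Submodule.mem_sup_right (Ideal.mem_span_singleton_self b)
  have hJfg : (toK K J).FG := (Submodule.FG.sup hF (Submodule.fg_span_singleton b)).map _
  have hloc : ∀ (M : Ideal D) [M.IsPrime], IsTMaximal K M → P ≤ M →
      toK K P ≤ localAt M (Submodule.span D {algebraMap D K b}) := by
    intro M _ hM hPM
    refine (hD.toK_le_localAt_span_mul hM.isTPrime hP.1 hPM hbP).trans (localAt_mono ?_)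
    exact (mul_le_mul_right (toK_le_one P) _).trans (mul_one _).le
  have hspan : Submodule.span D {algebraMap D K b} ≤ toK K J :=
    (Submodule.span_singleton_le_iff_mem _ _).2 (algebraMap_mem_toK.2 hbJ)
  have hPJ : toK K P ≤ tClosure (toK K J) := by
    intro x hx
    refine mem_tClosure_of_forall_isTMaximal
      (toK_ne_bot fun h => hF0 (le_bot_iff.1 (h ▸ le_sup_left))) fun M hM => ?_
    have := hM.isPrime
    by_cases hPM : P ≤ M
    · exact localAt_mono hspan (hloc M hM hPM hx)
    · obtain ⟨u, hu, huM⟩ := SetLike.not_le_iff_exists.1 (mt (hFM M hM) hPM)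
      obtain ⟨q, -, rfl⟩ := (IsLocalization.mem_coeSubmodule K _).1 hx
      refine ⟨u, huM, ?_⟩
      rw [Algebra.smul_def, ← map_mul, algebraMap_mem_toK]
      exact J.mul_mem_right q (Submodule.mem_sup_left hu)
  have hdJ : algebraMap D K d ∈ tClosure (toK K J) := by
    refine vClosure_le_tClosure hJfg ?_
    rw [← vClosure_vClosure]
    exact vClosure_mono (hPJ.trans (tClosure_le_vClosure _)) hx
  obtain ⟨M, hM, hPM⟩ := hP.2.exists_le_isTMaximal hP.1.ne_top
  have := hM.isPrime
  have hJloc : toK K J ≤ localAt M (Submodule.span D {algebraMap D K b}) := by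
    rw [hJ, toK, IsLocalization.coeSubmodule_sup, IsLocalization.coeSubmodule_span_singleton]
    exact sup_le ((toK_mono hFP).trans (hloc M hM hPM)) (le_localAt M _)
  obtain ⟨s, hs, hsd⟩ := localAt_le_localAt hJloc
    (hD.tClosure_le_localAt hM.isTPrime
      (toK_ne_bot fun h => hF0 (le_bot_iff.1 (h ▸ le_sup_left))) hdJ)
  obtain ⟨r, hr⟩ := Submodule.mem_span_singleton.1 hsd
  have hd0 : d ≠ 0 := fun h => hdP (h ▸ P.zero_mem)
  have hsr : d * s = d * (r * d * a) := by
    apply IsFractionRing.injective D K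
    simp only [hb, Algebra.smul_def, map_mul, map_pow] at hr ⊢
    linear_combination -hr
  exact hs (mul_left_cancel₀ hd0 hsr ▸ M.mul_mem_left _ (ha M hM hPM))

theorem IsDivisorial.multiset_inf {s : Multiset (Ideal D)} (h : ∀ P ∈ s, IsDivisorial K P) :
    IsDivisorial K s.inf := by
  refine le_antisymm (fun x hx => ?_) (le_vClosure _)
  have hx1 := vClosure_mono (toK_le_one _) hx
  rw [vClosure_one] at hx1
  obtain ⟨d, rfl⟩ := Submodule.mem_one.1 hx1
  have : Ideal.span {d} ≤ s.inf := Multiset.le_inf.2 fun P hP => by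
    rw [Ideal.span_singleton_le_iff_mem, ← algebraMap_mem_toK (K := K), ← h P hP]
    exact vClosure_mono (toK_mono (Multiset.inf_le hP)) hx
  exact algebraMap_mem_toK.2 ((Ideal.span_singleton_le_iff_mem _).1 this)

/-- Incomparable `t`-prime factors are among the factors of any `t`-product of `t`-primes. -/
theorem IsTProduct.mem_of_mem_incomparable {I : Ideal D} {s u : Multiset (Ideal D)}
    (hs : ∀ P ∈ s, IsTPrime K P) (hu : ∀ P ∈ u, IsTPrime K P) (hinc : Incomparable s)
    (hIs : IsTProduct K I s) (hIu : IsTProduct K I u) {P : Ideal D} (hP : P ∈ s) : P ∈ u := by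
  -- Primeness yields `P' ≤ Q ≤ P` with `Q ∈ u` and `P' ∈ s`; incomparability collapses the chain.
  obtain ⟨Q, hQ, hQP⟩ := (hs P hP).1.multiset_prod_le.1
    (hIu.prod_le.trans (hIs.le_of_mem hP (hs P hP).2))
  obtain ⟨P', hP', hPQ⟩ := (hu Q hQ).1.multiset_prod_le.1
    (hIs.prod_le.trans (hIu.le_of_mem hQ (hu Q hQ).2))
  have : P' = P := hinc.eq_of_le hP' hP (hPQ.trans hQP)
  rwa [le_antisymm (this ▸ hPQ) hQP]

end Divisorial

end StarOp

theorem mainTheorem11 (D K : Type*) [CommRing D] [IsDomain D] [Field K] [Algebra D K]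
    [IsFractionRing D K] (hD : StarOp.IsPvMD D K) (hfc : StarOp.HasFiniteTCharacter D K)
    (I : Ideal D) (hI0 : I ≠ ⊥) (hI : StarOp.IsTIdeal K I) :
    (StarOp.IsTIdempotent K I ↔
      ∃ s : Multiset (Ideal D),
        (∀ P ∈ s, StarOp.IsTPrime K P ∧ StarOp.IsTIdempotent K P) ∧
        StarOp.IsTProduct K I s) ∧
    List.TFAE [
      StarOp.IsTIdempotent K I ∧ StarOp.IsDivisorial K I,
      ∃ s : Multiset (Ideal D),
        (∀ P ∈ s, StarOp.IsTPrime K P ∧ StarOp.IsTIdempotent K P ∧ ¬ StarOp.IsTMaximal K P) ∧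
        StarOp.IsTProduct K I s,
      ∃ s : Multiset (Ideal D),
        (∀ P ∈ s, StarOp.IsTPrime K P ∧ StarOp.IsTIdempotent K P ∧ StarOp.IsDivisorial K P) ∧
        StarOp.IsTProduct K I s,
      ∃! s : Multiset (Ideal D),
        (∀ P ∈ s, StarOp.IsTPrime K P ∧ StarOp.IsTIdempotent K P ∧ StarOp.IsDivisorial K P) ∧
        StarOp.Incomparable s ∧
        StarOp.IsTProduct K I s] := by
  refine ⟨⟨fun h => ?_, fun ⟨s, hs, hIs⟩ => hIs.isTIdempotent hD hs⟩, ?_⟩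
  · obtain ⟨s, hs, -, hIs⟩ := h.exists_incomparable_isTProduct hD hfc hI
    exact ⟨s, hs, hIs⟩
  tfae_have 1 → 2 := by
    rintro ⟨hidem, hdiv⟩
    obtain ⟨s, hs, hinc, hIs⟩ := hidem.exists_incomparable_isTProduct hD hfc hI
    exact ⟨s, fun P hP => ⟨(hs P hP).1, (hs P hP).2,
      hdiv.not_isTMaximal_of_mem hD hs hinc hIs hP⟩, hIs⟩
  tfae_have 2 → 3 := by
    rintro ⟨s, hs, hIs⟩
    exact ⟨s, fun P hP => ⟨(hs P hP).1, (hs P hP).2.1,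
      (hs P hP).1.isDivisorial hD hfc (hs P hP).2.2⟩, hIs⟩
  tfae_have 3 → 4 := by
    rintro ⟨u, hu, hIu⟩
    have hidem := hIu.isTIdempotent hD fun P hP => ⟨(hu P hP).1, (hu P hP).2.1⟩
    obtain ⟨s, hs, hinc, hIs⟩ := hidem.exists_incomparable_isTProduct hD hfc hI
    -- The factors of the incomparable decomposition occur in `u`, and so inherit divisoriality.
    refine ⟨s, ⟨fun P hP => hu P ?_, hinc, hIs⟩, fun w ⟨hw, hwinc, hIw⟩ => ?_⟩
    · exact hIs.mem_of_mem_incomparable (fun P hP => (hs P hP).1) (fun P hP => (hu P hP).1)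
        hinc hIu hP
    · refine (hwinc.1.ext hinc.1).2 fun P => ⟨fun hP => ?_, fun hP => ?_⟩
      · exact hIw.mem_of_mem_incomparable (fun P hP => (hw P hP).1) (fun P hP => (hs P hP).1)
          hwinc hIs hP
      · exact hIs.mem_of_mem_incomparable (fun P hP => (hs P hP).1) (fun P hP => (hw P hP).1)
          hinc hIw hP
  tfae_have 4 → 1 := by
    rintro ⟨s, ⟨hs, hinc, hIs⟩, -⟩
    refine ⟨hIs.isTIdempotent hD fun P hP => ⟨(hs P hP).1, (hs P hP).2.1⟩, ?_⟩
    rw [(hD.isTProduct_iff_eq_inf hinc fun P hP => (hs P hP).1).1 hIs]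
    exact StarOp.IsDivisorial.multiset_inf fun P hP => (hs P hP).2.2
  tfae_finish
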